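/- A point cloud of size $n$ is a tuple $P=(p_1,\dots,p_n)$ of points of $\mathbb{R}^3$ (not necessarily distinct, without node features, so that all nodes carry one common feature $x$). Two point clouds are isomorphic if they have the same size and differ by a permutation of the nodes, an orthogonal transformation and a translation. A map on point clouds of all sizes is E(3)-complete if it takes equal values on isomorphic point clouds and different values on non-isomorphic ones. Write $d_{ij}=\|p_i-p_j\|$, $\theta_{kij}$ for the angle at $p_i$ between $p_k$ and $p_j$, and $\theta_{ijba}$ for the dihedral angle along $p_jp_b$ between the half-planes through $p_i$ and $p_a$ (fixed isometry-invariant conventions apply to undefined angles). $\{\!\!\{\cdot\}\!\!\}$ denotes a multiset. The following models maintain a representation $h_{ij}$ for each ordered pair $(i,j)$, including $i=j$, with $d_{ij}\le r_{\mathrm{embed}}$, initialized as $h_{ij}^{(0)}=f_{\mathrm{init}}(x,x,d_{ij})$ and updated in $L$ aggregation layers; in all multisets only pairs that have a representation occur. - DimeNet: $h_{ij}^{(l+1)}=f^{(l)}_{\mathrm{update}}\big(h_{ij}^{(l)},\{\!\!\{(\theta_{kij},h_{ki}^{(l)},d_{ij}) \mid d_{ki}\le r_{\mathrm{int}}\}\!\!\}\big)$,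 with output $f_{\mathrm{output}}(\{\!\!\{\{\!\!\{h_{ij}^{(L)}\mid i\}\!\!\}\mid j\}\!\!\})$. - SphereNet (without the azimuthal angle): $h_{ij}^{(l+1)}=f^{(l)}_{\mathrm{update}}\big(h_{ij}^{(l)},v_i^{(l)},v_j^{(l)},\{\!\!\{(h_{ki}^{(l)},d_{ki},\theta_{kij}) \mid d_{ki}\le r_{\mathrm{int}}\}\!\!\}\big)$, where $v_j^{(l)}=f^{(l)}_{\mathrm{node}}(\{\!\!\{h_{ij}^{(l)}\mid i\}\!\!\})$, with output $f_{\mathrm{graph}}(\{\!\!\{v_j^{(L)}\mid j\}\!\!\})$. - GemNet: $h_{ij}^{(l+1)}=f^{(l)}_{\mathrm{update}}\big(h_{ij}^{(l)},\{\!\!\{(h_{ab}^{(l)},d_{ij},d_{bj},d_{ab},\theta_{ijb},\theta_{jba},\theta_{ijba}) \mid a,b,\ d_{bj}\le r_{\mathrm{int}}\}\!\!\}\big)$, with output as for DimeNet. The neighbors $k$, $b$ and $a$ may coincide with the end nodes $i$, $j$. The models are considered in their maximally expressive form: all the functions $f$ above are injective (they do not depend on the size of the point cloud). **Theorem.** There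 is a constant $C$, which depends neither on the number of nodes nor on the functions $f$, such that every DimeNet, every SphereNet (without the azimuthal angle) and every GemNet with $L>C$ aggregation layers, $r_{\mathrm{embed}}=+\infty$ and $r_{\mathrm{int}}=+\infty$ is E(3)-complete. -/

import Mathlib

universe u v

open scoped ENNReal

noncomputable section

/-- Euclidean three-space. -/
abbrev E3 : Type := EuclideanSpace ℝ (Fin 3)

/-- An unlabeled point cloud with `n` nodes, that is, an element of `ℝ^(n × 3)`.
Nodes are allowed to coincide. -/
abbrev PointCloud (n : ℕ) : Type := Fin n → E3

/-- Two point clouds are isomorphic if they differ by a relabeling of the nodes, an orthogonal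
transformation and a translation (the bijection `σ` forces the sizes to agree). -/
def PointCloud.Isomorphic {m n : ℕ} (P : PointCloud m) (Q : PointCloud n) : Prop :=
  ∃ (σ : Fin m ≃ Fin n) (R : E3 ≃ₗᵢ[ℝ] E3) (t : E3), ∀ i, Q (σ i) = R (P i) + t

/-- A map on point clouds of all sizes is E(3)-complete if it is a permutation- and
E(3)-invariant map that takes different values on any two non-isomorphic point clouds. -/
structure E3Complete {T : Type v} (f : ∀ n : ℕ, PointCloud n → T) : Prop where
  invariant : ∀ {m n : ℕ} (P : PointCloud m) (Q : PointCloud n),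
    P.Isomorphic Q → f m P = f n Q
  distinguishes : ∀ {m n : ℕ} (P : PointCloud m) (Q : PointCloud n),
    ¬ P.Isomorphic Q → f m P ≠ f n Q

/-- The component of `u` orthogonal to `w`. -/
def perpComponent (w u : E3) : E3 := u - (inner ℝ w u / inner ℝ w w) • w

/-- The (unsigned) dihedral angle in `[0, π]` between the half-planes that are bounded by the
line `bc` and contain `a` and `d` respectively. If one of these half-planes is undetermined, the
value is given by the convention that division by zero gives zero and that the angle with the
zero vector is `π / 2`; it is still invariant under isometries. -/
def dihedralAngle (a b c d : E3) : ℝ :=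
  InnerProductGeometry.angle (perpComponent (c - b) (a - b)) (perpComponent (c - b) (d - c))

open Classical in
/-- The nodes whose distance to node `i` is at most `r` (node `i` itself is one of them). -/
def PointCloud.within {n : ℕ} (P : PointCloud n) (r : ℝ≥0∞) (i : Fin n) : Finset (Fin n) :=
  Finset.univ.filter fun k => edist (P k) (P i) ≤ r

/-! ### DimeNet -/

/-- A DimeNet with `L` aggregation layers and outputs in `T`: cutoffs, spaces of node features
and of edge representations, and the intermediate functions. Only the layers `l < L` are used.
As point clouds are unlabeled, all nodes carry the same feature `x₀`. -/
structure DimeNet (L : ℕ) (T : Type v) where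
  /-- the edges with a representation are those of length at most `rEmbed` -/
  rEmbed : ℝ≥0∞
  /-- interaction cutoff -/
  rInt : ℝ≥0∞
  /-- node features -/
  X : Type u
  x₀ : X
  /-- edge representations at each layer -/
  H : ℕ → Type u
  /-- `(x_i, x_j, d_ij) ↦ h_ij` -/
  init : X × X × ℝ → H 0
  /-- `(h_ij, {{(θ_kij, h_ki, d_ij)}}) ↦ h_ij` -/
  update : ∀ l : ℕ, H l × Multiset (ℝ × H l × ℝ) → H (l + 1)
  /-- pooling of all edge representations -/
  output : Multiset (Multiset (H L)) → T

namespace DimeNet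

variable {L : ℕ} {T : Type v}

/-- All intermediate functions are injective (the maximally expressive form of the model). -/
structure AllInjective (M : DimeNet.{u, v} L T) : Prop where
  init : Function.Injective M.init
  update : ∀ l < L, Function.Injective (M.update l)
  output : Function.Injective M.output

/-- The representation `h_ij` of the edge `ij` after `l` layers. The end nodes `i` and `j` are not
excluded from the neighbors `k`. -/
def edgeRep (M : DimeNet.{u, v} L T) {n : ℕ} (P : PointCloud n) :
    (l : ℕ) → Fin n → Fin n → M.H l
  | 0 => fun i j => M.init (M.x₀, M.x₀, dist (P i) (P j))
  | l + 1 => fun i j =>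
      M.update l (edgeRep M P l i j,
        (P.within M.rEmbed i ∩ P.within M.rInt i).val.map fun k =>
          (EuclideanGeometry.angle (P k) (P i) (P j), edgeRep M P l k i, dist (P i) (P j)))

/-- The representation of a point cloud computed by a DimeNet. -/
def eval (M : DimeNet.{u, v} L T) (n : ℕ) (P : PointCloud n) : T :=
  M.output ((Finset.univ : Finset (Fin n)).val.map fun j =>
    (P.within M.rEmbed j).val.map fun i => M.edgeRep P L i j)

end DimeNet

/-! ### SphereNet without the azimuthal angle -/

/-- A SphereNet (without the relative azimuthal angle) with `L` aggregation layers and outputs in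
`T`. -/
structure SphereNet (L : ℕ) (T : Type v) where
  /-- the edges with a representation are those of length at most `rEmbed` -/
  rEmbed : ℝ≥0∞
  /-- interaction cutoff -/
  rInt : ℝ≥0∞
  /-- node features -/
  X : Type u
  x₀ : X
  /-- edge representations at each layer -/
  H : ℕ → Type u
  /-- node representations at each layer -/
  V : ℕ → Type u
  /-- `(x_i, x_j, d_ij) ↦ h_ij` -/
  init : X × X × ℝ → H 0
  /-- `{{h_ij | i}} ↦ v_j` -/
  node : ∀ l : ℕ, Multiset (H l) → V l
  /-- `(h_ij, v_i, v_j, {{(h_ki, d_ki, θ_kij)}}) ↦ h_ij` -/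
  update : ∀ l : ℕ, H l × V l × V l × Multiset (H l × ℝ × ℝ) → H (l + 1)
  /-- pooling of all node representations -/
  graph : Multiset (V L) → T

namespace SphereNet

variable {L : ℕ} {T : Type v}

/-- All intermediate functions are injective (the maximally expressive form of the model). -/
structure AllInjective (M : SphereNet.{u, v} L T) : Prop where
  init : Function.Injective M.init
  node : ∀ l ≤ L, Function.Injective (M.node l)
  update : ∀ l < L, Function.Injective (M.update l)
  graph : Function.Injective M.graph

/-- The node representation `v_j` obtained at layer `l` from the edge representations `h`. -/
def nodeRep (M : SphereNet.{u, v} L T) {n : ℕ} (P : PointCloud n) (l : ℕ)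
    (h : Fin n → Fin n → M.H l) (j : Fin n) : M.V l :=
  M.node l ((P.within M.rEmbed j).val.map fun i => h i j)

/-- The representation `h_ij` of the edge `ij` after `l` layers. The end nodes `i` and `j` are not
excluded from the neighbors `k`. -/
def edgeRep (M : SphereNet.{u, v} L T) {n : ℕ} (P : PointCloud n) :
    (l : ℕ) → Fin n → Fin n → M.H l
  | 0 => fun i j => M.init (M.x₀, M.x₀, dist (P i) (P j))
  | l + 1 => fun i j =>
      M.update l (edgeRep M P l i j,
        M.nodeRep P l (edgeRep M P l) i, M.nodeRep P l (edgeRep M P l) j,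
        (P.within M.rEmbed i ∩ P.within M.rInt i).val.map fun k =>
          (edgeRep M P l k i, dist (P k) (P i), EuclideanGeometry.angle (P k) (P i) (P j)))

/-- The representation of a point cloud computed by a SphereNet. -/
def eval (M : SphereNet.{u, v} L T) (n : ℕ) (P : PointCloud n) : T :=
  M.graph ((Finset.univ : Finset (Fin n)).val.map fun j =>
    M.nodeRep P L (M.edgeRep P L) j)

end SphereNet

/-! ### GemNet -/

/-- A GemNet with `L` aggregation layers and outputs in `T`. -/
structure GemNet (L : ℕ) (T : Type v) where
  /-- the edges with a representation are those of length at most `rEmbed` -/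
  rEmbed : ℝ≥0∞
  /-- interaction cutoff -/
  rInt : ℝ≥0∞
  /-- node features -/
  X : Type u
  x₀ : X
  /-- edge representations at each layer -/
  H : ℕ → Type u
  /-- `(x_i, x_j, d_ij) ↦ h_ij` -/
  init : X × X × ℝ → H 0
  /-- `(h_ij, {{(h_ab, d_ij, d_bj, d_ab, θ_ijb, θ_jba, θ_ijba)}}) ↦ h_ij` -/
  update : ∀ l : ℕ, H l × Multiset (H l × ℝ × ℝ × ℝ × ℝ × ℝ × ℝ) → H (l + 1)
  /-- pooling of all edge representations -/
  output : Multiset (Multiset (H L)) → T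

namespace GemNet

variable {L : ℕ} {T : Type v}

/-- All intermediate functions are injective (the maximally expressive form of the model). -/
structure AllInjective (M : GemNet.{u, v} L T) : Prop where
  init : Function.Injective M.init
  update : ∀ l < L, Function.Injective (M.update l)
  output : Function.Injective M.output

/-- The representation `h_ij` of the edge `ij` after `l` layers. The message passing runs over the
nodes `b` that interact with `j` and the edges `ab` that have a representation; no coincidences
between `i`, `j`, `b` and `a` are excluded. -/
def edgeRep (M : GemNet.{u, v} L T) {n : ℕ} (P : PointCloud n) :
    (l : ℕ) → Fin n → Fin n → M.H l
  | 0 => fun i j => M.init (M.x₀, M.x₀, dist (P i) (P j))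
  | l + 1 => fun i j =>
      M.update l (edgeRep M P l i j,
        ((P.within M.rInt j).sigma fun b => P.within M.rEmbed b).val.map fun q =>
          (edgeRep M P l q.2 q.1,
            dist (P i) (P j), dist (P q.1) (P j), dist (P q.2) (P q.1),
            EuclideanGeometry.angle (P i) (P j) (P q.1),
            EuclideanGeometry.angle (P j) (P q.1) (P q.2),
            dihedralAngle (P i) (P j) (P q.1) (P q.2)))

/-- The representation of a point cloud computed by a GemNet. -/
def eval (M : GemNet.{u, v} L T) (n : ℕ) (P : PointCloud n) : T :=
  M.output ((Finset.univ : Finset (Fin n)).val.map fun j =>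
    (P.within M.rEmbed j).val.map fun i => M.edgeRep P L i j)

end GemNet

end

/-! Injectivity turns equal outputs into reindexings of nodes that preserve all aggregated data. By
the law of cosines, one layer at the pair (i, j) yields the multiset over k of d_kj together with
the representation of (k, i). Two layers therefore lead from (i, j) to the pairs (i, k) with the
same root i, since in the second layer the term with neighbor at i is recognized by distance zero.
In this form (`LooksAlike`) the sums of squared distances give the distances to the centroid, hence
inner products of centered positions (`LooksAlike.sameGram`).

It remains to reconstruct a finite family p in three-space (`exists_equiv_of_sameGram`). Lengths and
inner products with p i and p j determine each point up to reflection in the plane of p i and p j.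
If all points lie in such a plane, this suffices. Otherwise choose k outside the plane so that p k
is angularly closest, about the axis p i, to the half-plane of p j. The view of (i, k) determines
the points up to reflection in the plane of p i and p k. The two views come with different
reindexings, so individual points cannot be followed from one to the other. Multiplicities can be
compared instead: after aligning p i, p j, p k, the difference of the multiplicities of the two
clouds is odd under both reflections. By the choice of k it vanishes in the open wedge between the
two half-planes, and a finitely supported function with these properties is zero
(`eq_zero_of_odd_of_chamber`).

Gram data cost two rooted rounds, and passing to k and then to all m costs two more. Each round
costs two layers, so eight layers suffice. -/

noncomputable section

/-! ### Multisets as families up to reindexing -/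

/-- Two finite families with fibers of the same sizes agree up to reindexing. -/
theorem exists_equiv_of_card_fiber_eq {ι κ α : Type*} [Finite ι] [Finite κ] {f : ι → α} {g : κ → α}
    (h : ∀ c, Nat.card {i // f i = c} = Nat.card {j // g j = c}) :
    ∃ σ : ι ≃ κ, ∀ i, f i = g (σ i) :=
  ⟨Equiv.ofFiberEquiv fun c => (Finite.card_eq.1 (h c)).some,
    fun i => (Equiv.ofFiberEquiv_map _ i).symm⟩

/-- Two finite families with the same multiset of values agree up to reindexing. -/
theorem exists_equiv_of_map_univ_eq {ι κ α : Type*} [Fintype ι] [Fintype κ] {f : ι → α} {g : κ → α}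
    (h : (Finset.univ : Finset ι).val.map f = (Finset.univ : Finset κ).val.map g) :
    ∃ σ : ι ≃ κ, ∀ i, f i = g (σ i) := by
  classical
  refine exists_equiv_of_card_fiber_eq fun c => ?_
  have := congrArg (Multiset.count c) h
  simp only [Multiset.count_map] at this
  rw [Nat.card_eq_fintype_card, Nat.card_eq_fintype_card, Fintype.card_subtype,
    Fintype.card_subtype]
  convert this using 1 <;>
  · rw [Finset.card_def, Finset.filter_val]
    simp only [eq_comm]

open Classical in
/-- The difference of the multiplicities of `x` in two finite families. -/
def countDiff {ι κ E : Type*} [Fintype ι] [Fintype κ] (p : ι → E) (q : κ → E) (x : E) : ℤ :=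
  (∑ i, if p i = x then 1 else 0) - ∑ j, if q j = x then 1 else 0

theorem exists_equiv_of_countDiff_eq_zero {ι κ E : Type*} [Fintype ι] [Fintype κ] {p : ι → E}
    {q : κ → E} (h : ∀ x, countDiff p q x = 0) : ∃ σ : ι ≃ κ, ∀ i, p i = q (σ i) := by
  classical
  refine exists_equiv_of_map_univ_eq (Multiset.ext.2 fun x => ?_)
  have hx := h x
  rw [countDiff, sub_eq_zero, Finset.sum_boole, Finset.sum_boole] at hx
  simp only [Multiset.count_map, ← Finset.filter_val, ← Finset.card_def, eq_comm (a := x)]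
  exact_mod_cast hx

theorem countDiff_ne_zero {ι κ E : Type*} [Fintype ι] [Fintype κ] {p : ι → E}
    {q : κ → E} {x : E} (h : countDiff p q x ≠ 0) : (∃ i, p i = x) ∨ ∃ j, q j = x := by
  by_contra! hx
  exact h (by simp [countDiff, hx.1, hx.2])

/-! ### Functions odd under two reflections -/

section Chamber

variable {E : Type*} [NormedAddCommGroup E] [InnerProductSpace ℝ E]

local notation "⟪" x ", " y "⟫" => inner ℝ x y

/-- The reflection in the hyperplane orthogonal to `n`. -/
def hyperplaneReflection (n x : E) : E := x - (2 * ⟪x, n⟫ / ⟪n, n⟫) • n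

theorem inner_hyperplaneReflection (n x v : E) :
    ⟪hyperplaneReflection n x, v⟫ = ⟪x, v⟫ - 2 * ⟪x, n⟫ / ⟪n, n⟫ * ⟪n, v⟫ := by
  rw [hyperplaneReflection, inner_sub_left, real_inner_smul_left]

theorem inner_hyperplaneReflection_normal {n : E} (hn : n ≠ 0) (x : E) :
    ⟪hyperplaneReflection n x, n⟫ = -⟪x, n⟫ := by
  have : ⟪n, n⟫ ≠ 0 := inner_self_ne_zero.2 hn
  rw [inner_hyperplaneReflection]
  field_simp
  ring

theorem hyperplaneReflection_involutive (n : E) :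
    Function.Involutive (hyperplaneReflection n) := fun x => by
  rcases eq_or_ne n 0 with rfl | hn
  · simp [hyperplaneReflection]
  · conv_lhs => rw [hyperplaneReflection, inner_hyperplaneReflection_normal hn]
    rw [hyperplaneReflection, sub_sub, ← add_smul]
    ring_nf
    simp

/-- Two vectors of the same length that differ by a multiple of `n` are equal or mirror images. -/
theorem eq_or_eq_hyperplaneReflection {n x y : E} {c : ℝ} (hxy : y - x = c • n)
    (hnorm : ‖x‖ = ‖y‖) : y = x ∨ y = hyperplaneReflection n x := by
  rcases eq_or_ne n 0 with rfl | hn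
  · left; simpa [sub_eq_zero] using hxy
  obtain rfl : y = x + c • n := by rw [← hxy]; abel
  have h0 : ⟪n, n⟫ ≠ 0 := inner_self_ne_zero.2 hn
  have h1 : ⟪x, x⟫ = ⟪x + c • n, x + c • n⟫ := by
    rw [real_inner_self_eq_norm_sq, real_inner_self_eq_norm_sq, hnorm]
  simp only [inner_add_left, inner_add_right, real_inner_smul_left, real_inner_smul_right,
    real_inner_comm x n] at h1
  have h2 : c * (2 * ⟪x, n⟫ + c * ⟪n, n⟫) = 0 := by linarith
  rcases mul_eq_zero.1 h2 with rfl | h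
  · left; simp
  · right
    have : c = -(2 * ⟪x, n⟫ / ⟪n, n⟫) := by field_simp; linarith
    rw [hyperplaneReflection, this, neg_smul, sub_eq_add_neg]

/-- A finitely supported function that is odd under two reflections vanishes if it vanishes
in the open chamber between the two mirrors. -/
theorem eq_zero_of_odd_of_chamber {D : E → ℤ} {S : Finset E} (hS : ∀ x, D x ≠ 0 → x ∈ S)
    {n₁ n₂ w : E} (h₁ : 0 < ⟪n₁, w⟫) (h₂ : 0 < ⟪n₂, w⟫)
    (hD₁ : ∀ x, D (hyperplaneReflection n₁ x) = -D x)
    (hD₂ : ∀ x, D (hyperplaneReflection n₂ x) = -D x)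
    (hchamber : ∀ x, 0 < ⟪x, n₁⟫ → 0 < ⟪x, n₂⟫ → D x = 0) (x : E) : D x = 0 := by
  classical
  by_contra hx
  -- Take a support point extremal in direction w. If it were on the negative side of a mirror, its
  -- reflection would be further in direction w; if it were on a mirror, oddness would give D y = 0.
  -- So it lies in the chamber. Finiteness of the support is what makes this work even if the two
  -- reflections generate an infinite group.
  obtain ⟨y, hy, hmax⟩ := (S.filter fun x => D x ≠ 0).exists_max_image (fun x => ⟪x, w⟫)
    ⟨x, by simp [hS x hx, hx]⟩
  have hy0 : D y ≠ 0 := (Finset.mem_filter.1 hy).2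
  have key : ∀ n : E, 0 < ⟪n, w⟫ → (∀ x, D (hyperplaneReflection n x) = -D x) → 0 < ⟪y, n⟫ := by
    intro n hn hD
    have hne : D (hyperplaneReflection n y) ≠ 0 := by rw [hD]; simpa using hy0
    have hle := hmax _ (Finset.mem_filter.2 ⟨hS _ hne, hne⟩)
    have hn0 : n ≠ 0 := by rintro rfl; simp at hn
    have hnn : 0 < ⟪n, n⟫ := real_inner_self_pos.2 hn0
    rw [inner_hyperplaneReflection] at hle
    have h3 : 0 ≤ 2 * ⟪y, n⟫ / ⟪n, n⟫ := by
      by_contra! hlt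
      nlinarith
    rcases lt_trichotomy ⟪y, n⟫ 0 with hlt | heq | hgt
    · have := div_neg_of_neg_of_pos (show 2 * ⟪y, n⟫ < 0 by linarith) hnn
      linarith
    · have := hD y
      rw [hyperplaneReflection, heq] at this
      simp only [mul_zero, zero_div, zero_smul, sub_zero] at this
      omega
    · exact hgt
  exact hy0 (hchamber y (key n₁ h₁ hD₁) (key n₂ h₂ hD₂))

/-- The contribution of p i and q (σ i) to the values at x and at its mirror image cancels for each
i separately. -/
theorem countDiff_hyperplaneReflection {ι κ : Type*} [Fintype ι] [Fintype κ] {p : ι → E}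
    {q : κ → E} {n : E} (σ : ι ≃ κ)
    (h : ∀ i, q (σ i) = p i ∨ q (σ i) = hyperplaneReflection n (p i)) (x : E) :
    countDiff p q (hyperplaneReflection n x) = -countDiff p q x := by
  classical
  have hinv := hyperplaneReflection_involutive n
  have hsym : ∀ x y, x = hyperplaneReflection n y ↔ hyperplaneReflection n x = y := fun x y =>
    ⟨fun h => by rw [h, hinv], fun h => by rw [← h, hinv]⟩
  have : countDiff p q (hyperplaneReflection n x) + countDiff p q x = 0 := by
    simp only [countDiff]
    rw [← Equiv.sum_comp σ (fun j => if q j = hyperplaneReflection n x then (1 : ℤ) else 0),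
      ← Equiv.sum_comp σ (fun j => if q j = x then (1 : ℤ) else 0), ← Finset.sum_sub_distrib,
      ← Finset.sum_sub_distrib, ← Finset.sum_add_distrib]
    refine Finset.sum_eq_zero fun i _ => ?_
    rcases h i with h | h
    · rw [h]; ring
    · rw [h]
      simp only [hsym (p i), hinv.injective.eq_iff]
      ring
  omega

end Chamber

/-! ### Isometries from Gram data -/

section Gram

variable {E : Type*} [NormedAddCommGroup E] [InnerProductSpace ℝ E] [FiniteDimensional ℝ E]

local notation "⟪" x ", " y "⟫" => inner ℝ x y

/-- Two finite families with the same Gram matrix differ by a linear isometry. -/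
theorem exists_linearIsometryEquiv_of_inner_eq {ι : Type*} [Fintype ι] {a b : ι → E}
    (h : ∀ i j, ⟪a i, a j⟫ = ⟪b i, b j⟫) : ∃ R : E ≃ₗᵢ[ℝ] E, ∀ i, R (a i) = b i := by
  classical
  set A : (ι → ℝ) →ₗ[ℝ] E := Fintype.linearCombination ℝ a with hA
  set B : (ι → ℝ) →ₗ[ℝ] E := Fintype.linearCombination ℝ b with hB
  have hnorm : ∀ x, ‖A x‖ = ‖B x‖ := fun x => by
    have : ⟪A x, A x⟫ = ⟪B x, B x⟫ := by
      simp only [hA, hB, Fintype.linearCombination_apply, sum_inner, inner_sum,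
        real_inner_smul_left, real_inner_smul_right, h]
    rw [real_inner_self_eq_norm_sq, real_inner_self_eq_norm_sq] at this
    exact (pow_left_inj₀ (norm_nonneg _) (norm_nonneg _) two_ne_zero).1 this
  -- g is a linear section of A onto its range. Since A and B give equal norms, B ∘ g is isometric
  -- and the kernel of A lies in that of B, so the choice of section does not matter.
  obtain ⟨g, hg⟩ := A.rangeRestrict.exists_rightInverse_of_surjective A.range_rangeRestrict
  have hg' : ∀ y : A.range, A (g y) = y := fun y => by
    have := LinearMap.congr_fun hg y
    simpa using congrArg Subtype.val this
  let f : A.range →ₗᵢ[ℝ] E := ⟨B ∘ₗ g, fun y => by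
    rw [LinearMap.comp_apply, ← hnorm, hg' y]; rfl⟩
  refine ⟨f.extend.toLinearIsometryEquiv rfl, fun i => ?_⟩
  have hi : A (Pi.single i 1) = a i := by simp [hA, Fintype.linearCombination_apply_single]
  have hi' : B (Pi.single i 1) = b i := by simp [hB, Fintype.linearCombination_apply_single]
  have h1 := f.extend_apply ⟨A (Pi.single i 1), ⟨_, rfl⟩⟩
  rw [LinearIsometry.coe_toLinearIsometryEquiv, ← hi, h1, ← hi']
  change B (g _) = _
  rw [← sub_eq_zero, ← map_sub, ← norm_eq_zero, ← hnorm, map_sub, hg', sub_self, norm_zero]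

/-- If all `x i` are in the span of `a`, then the Gram data relative to `a` determine `x`. -/
theorem exists_linearIsometryEquiv_of_mem_span {ι κ : Type*} [Fintype ι] {a b : ι → E}
    (h : ∀ i j, ⟪a i, a j⟫ = ⟪b i, b j⟫) {x y : κ → E}
    (hx : ∀ k, x k ∈ Submodule.span ℝ (Set.range a)) (hnorm : ∀ k, ‖x k‖ = ‖y k‖)
    (hinner : ∀ k i, ⟪x k, a i⟫ = ⟪y k, b i⟫) : ∃ R : E ≃ₗᵢ[ℝ] E, ∀ k, R (x k) = y k := by
  obtain ⟨R, hR⟩ := exists_linearIsometryEquiv_of_inner_eq h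
  refine ⟨R, fun k => ?_⟩
  have key : ∀ z ∈ Submodule.span ℝ (Set.range a), ⟪x k, z⟫ = ⟪y k, R z⟫ := fun z hz => by
    induction hz using Submodule.span_induction with
    | mem z hz => obtain ⟨i, rfl⟩ := hz; rw [hR, hinner]
    | zero => simp
    | add u w _ _ hu hw => rw [map_add, inner_add_right, inner_add_right, hu, hw]
    | smul c u _ hu => rw [map_smul, real_inner_smul_right, real_inner_smul_right, hu]
  have h1 := key _ (hx k)
  have h2 : ‖R (x k) - y k‖ ^ 2 = 0 := by
    rw [norm_sub_sq_real, R.norm_map, real_inner_comm, ← h1, real_inner_self_eq_norm_sq, hnorm]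
    ring
  simpa [sub_eq_zero] using h2

end Gram

/-! ### Reconstruction in three-space from rooted views -/

section Reconstruction

variable {E : Type*} [NormedAddCommGroup E] [InnerProductSpace ℝ E]

local notation "⟪" x ", " y "⟫" => inner ℝ x y

theorem finrank_orthogonal_span_pair (hE : Module.finrank ℝ E = 3) {a b : E}
    (hab : LinearIndependent ℝ ![a, b]) :
    Module.finrank ℝ (Submodule.span ℝ (Set.range ![a, b]))ᗮ = 1 := by
  have : FiniteDimensional ℝ E := Module.finite_of_finrank_pos (by omega)
  have h1 := (Submodule.span ℝ (Set.range ![a, b])).finrank_add_finrank_orthogonal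
  rw [finrank_span_eq_card hab, hE, Fintype.card_fin] at h1
  omega

theorem mem_orthogonal_span_pair {a b z : E} :
    z ∈ (Submodule.span ℝ (Set.range ![a, b]))ᗮ ↔ ⟪z, a⟫ = 0 ∧ ⟪z, b⟫ = 0 := by
  simp only [Submodule.mem_orthogonal']
  constructor
  · exact fun h => ⟨h a (Submodule.subset_span ⟨0, rfl⟩), h b (Submodule.subset_span ⟨1, rfl⟩)⟩
  · rintro ⟨ha, hb⟩ u hu
    induction hu using Submodule.span_induction with
    | mem z hz =>
      obtain ⟨i, rfl⟩ := hz
      fin_cases i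
      · exact ha
      · exact hb
    | zero => simp
    | add u w _ _ hu hw => rw [inner_add_right, hu, hw, add_zero]
    | smul c u _ hu => rw [real_inner_smul_right, hu, mul_zero]

theorem exists_smul_eq_of_inner_eq_zero (hE : Module.finrank ℝ E = 3) {a b n z : E}
    (hab : LinearIndependent ℝ ![a, b]) (hn : n ≠ 0) (hna : ⟪n, a⟫ = 0) (hnb : ⟪n, b⟫ = 0)
    (hza : ⟪z, a⟫ = 0) (hzb : ⟪z, b⟫ = 0) : ∃ c : ℝ, z = c • n := by
  have hn' := mem_orthogonal_span_pair.2 ⟨hna, hnb⟩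
  have hz' := mem_orthogonal_span_pair.2 ⟨hza, hzb⟩
  obtain ⟨c, hc⟩ := (finrank_eq_one_iff_of_nonzero' (⟨n, hn'⟩ :
    (Submodule.span ℝ (Set.range ![a, b]))ᗮ) (by simpa using hn)).1
    (finrank_orthogonal_span_pair hE hab) ⟨z, hz'⟩
  exact ⟨c, (congrArg Subtype.val hc).symm⟩

theorem exists_normal (hE : Module.finrank ℝ E = 3) {a b : E}
    (hab : LinearIndependent ℝ ![a, b]) : ∃ n : E, n ≠ 0 ∧ ⟪n, a⟫ = 0 ∧ ⟪n, b⟫ = 0 := by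
  obtain ⟨⟨n, hn⟩, hn0, -⟩ := finrank_eq_one_iff'.1 (finrank_orthogonal_span_pair hE hab)
  exact ⟨n, by simpa using hn0, mem_orthogonal_span_pair.1 hn⟩

theorem mem_span_pair_of_inner_normal_eq_zero (hE : Module.finrank ℝ E = 3) {a b n x : E}
    (hab : LinearIndependent ℝ ![a, b]) (hn : n ≠ 0) (hna : ⟪n, a⟫ = 0) (hnb : ⟪n, b⟫ = 0)
    (hx : ⟪x, n⟫ = 0) : x ∈ Submodule.span ℝ (Set.range ![a, b]) := by
  have : FiniteDimensional ℝ E := Module.finite_of_finrank_pos (by omega)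
  rw [← (Submodule.span ℝ (Set.range ![a, b])).orthogonal_orthogonal,
    Submodule.mem_orthogonal']
  intro z hz
  obtain ⟨hza, hzb⟩ := mem_orthogonal_span_pair.1 hz
  obtain ⟨c, rfl⟩ := exists_smul_eq_of_inner_eq_zero hE hab hn hna hnb hza hzb
  rw [real_inner_smul_right, hx, mul_zero]

theorem linearIndependent_pair_of_inner_ne_zero {a b n : E} (ha : a ≠ 0) (hna : ⟪a, n⟫ = 0)
    (hb : ⟪b, n⟫ ≠ 0) : LinearIndependent ℝ ![a, b] := by
  rw [LinearIndependent.pair_iff' ha]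
  rintro c rfl
  rw [real_inner_smul_left, hna, mul_zero] at hb
  exact hb rfl

/-- Vectors with the same length and the same inner products with `a` and `b` are equal or mirror
images in the plane spanned by `a` and `b`. -/
theorem eq_or_eq_hyperplaneReflection_of_inner_eq (hE : Module.finrank ℝ E = 3) {a b n x y : E}
    (hab : LinearIndependent ℝ ![a, b]) (hn : n ≠ 0) (hna : ⟪n, a⟫ = 0) (hnb : ⟪n, b⟫ = 0)
    (hxy : ‖x‖ = ‖y‖) (ha : ⟪x, a⟫ = ⟪y, a⟫) (hb : ⟪x, b⟫ = ⟪y, b⟫) :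
    y = x ∨ y = hyperplaneReflection n x := by
  obtain ⟨c, hc⟩ := exists_smul_eq_of_inner_eq_zero (z := y - x) hE hab hn hna hnb
    (by rw [inner_sub_left, ha, sub_self]) (by rw [inner_sub_left, hb, sub_self])
  exact eq_or_eq_hyperplaneReflection hc hxy

/-- Two families in three-space coincide up to reindexing if they have the same
mirror-symmetrization with respect to the planes `⟨a, b⟩` and `⟨a, d⟩`, and no member of the first
family is angularly closer to the half-plane of `b` than `d` without being in its plane. The
vectors `a`, `e`, `n` are orthogonal, `n` is normal to the plane of `a` and `b`. -/
theorem exists_equiv_of_two_planes (hE : Module.finrank ℝ E = 3) {ι κ : Type*} [Fintype ι]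
    [Fintype κ] {p : ι → E} {q : κ → E} {a b d e n : E} (hab : LinearIndependent ℝ ![a, b])
    (hn : n ≠ 0) (hna : ⟪n, a⟫ = 0) (hnb : ⟪n, b⟫ = 0) (he : e ≠ 0) (hea : ⟪e, a⟫ = 0)
    (hen : ⟪e, n⟫ = 0) (hdn : 0 < ⟪d, n⟫)
    (hmax : ∀ i, ⟪p i, n⟫ ≠ 0 → ⟪p i, e⟫ / |⟪p i, n⟫| ≤ ⟪d, e⟫ / |⟪d, n⟫|)
    (σ τ : ι ≃ κ) (hσ : ∀ i, ‖p i‖ = ‖q (σ i)‖) (hσa : ∀ i, ⟪p i, a⟫ = ⟪q (σ i), a⟫)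
    (hσb : ∀ i, ⟪p i, b⟫ = ⟪q (σ i), b⟫)
    (hτ : ∀ i, ‖p i‖ = ‖q (τ i)‖) (hτa : ∀ i, ⟪p i, a⟫ = ⟪q (τ i), a⟫)
    (hτd : ∀ i, ⟪p i, d⟫ = ⟪q (τ i), d⟫) : ∃ π : ι ≃ κ, ∀ i, p i = q (π i) := by
  classical
  -- A normal to the plane of a and d. On the side ⟪x, n⟫ > 0, positivity of ⟪x, n'⟫ says that ⟪x,
  -- e⟫ / ⟪x, n⟫ exceeds the ratio for d, so x lies strictly between the half-planes of b and d.
  set n' : E := ⟪d, n⟫ • e - ⟪d, e⟫ • n with hn'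
  have hnn : 0 < ⟪n, n⟫ := real_inner_self_pos.2 hn
  have hee : 0 < ⟪e, e⟫ := real_inner_self_pos.2 he
  have hne : ⟪n, e⟫ = 0 := by rw [real_inner_comm, hen]
  have hinn' : ∀ x, ⟪x, n'⟫ = ⟪d, n⟫ * ⟪x, e⟫ - ⟪d, e⟫ * ⟪x, n⟫ := fun x => by
    rw [hn', inner_sub_right, real_inner_smul_right, real_inner_smul_right]
  have hn'0 : n' ≠ 0 := by
    intro h0
    have h1 := hinn' e
    rw [h0, inner_zero_right, hen] at h1
    nlinarith [mul_pos hdn hee]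
  have hn'a : ⟪n', a⟫ = 0 := by
    rw [real_inner_comm, hinn', real_inner_comm e a, real_inner_comm n a, hea, hna]; ring
  have hn'd : ⟪n', d⟫ = 0 := by rw [real_inner_comm, hinn']; ring
  have ha0 : a ≠ 0 := by
    have := hab.ne_zero 0
    simpa using this
  have had : LinearIndependent ℝ ![a, d] :=
    linearIndependent_pair_of_inner_ne_zero (n := n) ha0 (by rw [real_inner_comm, hna]) hdn.ne'
  have hσ' := fun i => eq_or_eq_hyperplaneReflection_of_inner_eq hE hab hn hna hnb
    (hσ i) (hσa i) (hσb i)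
  have hτ' := fun i => eq_or_eq_hyperplaneReflection_of_inner_eq hE had hn'0 hn'a hn'd
    (hτ i) (hτa i) (hτd i)
  -- Reflection in the plane of a and b keeps the e-component and negates the n-component. This form
  -- thus covers the members of q as well, each being some p i or its mirror image.
  have hfar : ∀ i (x : E), ⟪x, e⟫ = ⟪p i, e⟫ → |⟪x, n⟫| = |⟪p i, n⟫| → 0 < ⟪x, n⟫ →
      ¬ 0 < ⟪x, n'⟫ := by
    intro i x h1 h2 h3 h4
    have h5 := hmax i (by rw [← abs_pos, ← h2]; exact abs_pos.2 h3.ne')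
    rw [← h1, ← h2, abs_of_pos h3, abs_of_pos hdn, div_le_div_iff₀ h3 hdn] at h5
    rw [hinn'] at h4
    linarith
  refine exists_equiv_of_countDiff_eq_zero
    (eq_zero_of_odd_of_chamber (S := Finset.univ.image p ∪ Finset.univ.image q)
    (n₁ := n) (n₂ := n')
    -- The coefficient of e is chosen to make ⟪n', w⟫ = 1.
    (w := n + ((⟪d, e⟫ * ⟪n, n⟫ + 1) / (⟪d, n⟫ * ⟪e, e⟫)) • e) (fun x hx => ?_) ?_ ?_
    (countDiff_hyperplaneReflection σ hσ') (countDiff_hyperplaneReflection τ hτ') ?_)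
  · simpa using countDiff_ne_zero hx
  · rwa [inner_add_right, real_inner_smul_right, hne, mul_zero, add_zero]
  · rw [real_inner_comm, hinn', inner_add_left, inner_add_left, real_inner_smul_left,
      real_inner_smul_left, hne, hen]
    have := mul_pos hdn hee
    field_simp
    linarith
  · intro x hx hx'
    by_contra h0
    rcases countDiff_ne_zero h0 with ⟨i, rfl⟩ | ⟨j, rfl⟩
    · exact hfar i _ rfl rfl hx hx'
    · obtain ⟨i, rfl⟩ := σ.surjective j
      rcases hσ' i with h | h
      · rw [h] at hx hx'
        exact hfar i _ rfl rfl hx hx'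
      · refine hfar i _ ?_ ?_ hx hx'
        · rw [h, inner_hyperplaneReflection, hne, mul_zero, sub_zero]
        · rw [h, inner_hyperplaneReflection_normal hn, abs_neg]

/-- `i, j` in the family `p` look the same as `i', j'` in the family `q`. -/
structure SameGram {ι κ : Type*} (p : ι → E) (q : κ → E) (i j : ι) (i' j' : κ) : Prop where
  left : ‖p i‖ = ‖q i'‖
  right : ‖p j‖ = ‖q j'‖
  inner_eq : ⟪p i, p j⟫ = ⟪q i', q j'⟫

theorem SameGram.inner_pair_eq {ι κ : Type*} {p : ι → E} {q : κ → E} {i j : ι} {i' j' : κ}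
    (h : SameGram p q i j i' j') (r s : Fin 2) :
    ⟪(![p i, p j]) r, (![p i, p j]) s⟫ = ⟪(![q i', q j']) r, (![q i', q j']) s⟫ := by
  fin_cases r <;> fin_cases s <;>
    simp [h.left, h.right, h.inner_eq, real_inner_comm (p i), real_inner_comm (q i')]

/-- Reconstruction of a finite family in three-space, up to isometry and reindexing, from
rooted local views. -/
theorem exists_equiv_of_sameGram (hE : Module.finrank ℝ E = 3) {ι κ : Type*} [Fintype ι]
    [Fintype κ] [Nonempty ι] {p : ι → E} {q : κ → E}
    (h : ∀ i j, ∃ i' j', SameGram p q i j i' j' ∧ ∃ σ : ι ≃ κ, ∀ k,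
      SameGram p q i k i' (σ k) ∧ ⟪p k, p j⟫ = ⟪q (σ k), q j'⟫ ∧ ∃ τ : ι ≃ κ, ∀ m,
        SameGram p q i m i' (τ m) ∧ ⟪p m, p k⟫ = ⟪q (τ m), q (σ k)⟫) :
    ∃ (R : E ≃ₗᵢ[ℝ] E) (π : ι ≃ κ), ∀ i, R (p i) = q (π i) := by
  have : FiniteDimensional ℝ E := Module.finite_of_finrank_pos (by omega)
  -- When two members span all the others, no reflection ambiguity remains and σ alone gives the
  -- matching.
  by_cases hplanar : ∃ i j, ∀ k, p k ∈ Submodule.span ℝ (Set.range ![p i, p j])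
  · obtain ⟨i, j, hij⟩ := hplanar
    obtain ⟨i', j', hg, σ, hσ⟩ := h i j
    obtain ⟨R, hR⟩ := exists_linearIsometryEquiv_of_mem_span (y := fun k => q (σ k))
      hg.inner_pair_eq hij (fun k => (hσ k).1.right) (fun k r => by
        fin_cases r
        · simpa [real_inner_comm (p i), real_inner_comm (q i')] using (hσ k).1.inner_eq
        · exact (hσ k).2.1)
    exact ⟨R, σ, hR⟩
  push Not at hplanar
  obtain ⟨i, hi⟩ : ∃ i, p i ≠ 0 := by
    by_contra! h0
    obtain ⟨k, hk⟩ := hplanar (Classical.arbitrary ι) (Classical.arbitrary ι)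
    refine hk ?_
    rw [h0 k]
    exact Submodule.zero_mem (Submodule.span ℝ (Set.range _))
  obtain ⟨j, hj⟩ := hplanar i i
  have hab : LinearIndependent ℝ ![p i, p j] := by
    rw [LinearIndependent.pair_iff' hi]
    rintro c hc
    refine hj ?_
    rw [← hc]
    exact Submodule.smul_mem _ _ (Submodule.subset_span ⟨0, rfl⟩)
  obtain ⟨n, hn, hna, hnb⟩ := exists_normal hE hab
  set e : E := p j - (⟪p j, p i⟫ / ⟪p i, p i⟫) • p i with he
  have hii : ⟪p i, p i⟫ ≠ 0 := inner_self_ne_zero.2 hi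
  have he0 : e ≠ 0 := fun h0 => by
    rw [LinearIndependent.pair_iff' hi] at hab
    exact hab _ (sub_eq_zero.1 h0).symm
  have hea : ⟪e, p i⟫ = 0 := by
    rw [he, inner_sub_left, real_inner_smul_left, div_mul_cancel₀ _ hii, sub_self]
  have hen : ⟪e, n⟫ = 0 := by
    rw [he, inner_sub_left, real_inner_smul_left, real_inner_comm n, real_inner_comm n, hna, hnb]
    ring
  obtain ⟨k₀, hk₀⟩ := hplanar i j
  have hk₀n : ⟪p k₀, n⟫ ≠ 0 := fun h0 =>
    hk₀ (mem_span_pair_of_inner_normal_eq_zero hE hab hn hna hnb h0)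
  classical
  -- Up to a positive constant the ratio is the cotangent of the angle about the axis p i from the
  -- half-plane of p j, so its maximum is the smallest angle. The absolute value identifies the two
  -- sides of the plane.
  obtain ⟨k, hk, hmax⟩ := (Finset.univ.filter fun k => ⟪p k, n⟫ ≠ 0).exists_max_image
    (fun k => ⟪p k, e⟫ / |⟪p k, n⟫|) ⟨k₀, by simp [hk₀n]⟩
  have hkn : ⟪p k, n⟫ ≠ 0 := (Finset.mem_filter.1 hk).2
  obtain ⟨i', j', hg, σ, hσ⟩ := h i j
  obtain ⟨hik, hjk, τ, hτ⟩ := hσ k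
  obtain ⟨R, hR⟩ := exists_linearIsometryEquiv_of_inner_eq
    (a := ![p i, p j, p k]) (b := ![q i', q j', q (σ k)]) (fun r s => by
      have h1 := hg.inner_eq
      have h2 := hik.inner_eq
      fin_cases r <;> fin_cases s <;>
        simp [hg.left, hg.right, hik.right, h1, h2, hjk, real_inner_comm (p i) (p j),
          real_inner_comm (q i') (q j'), real_inner_comm (p i) (p k),
          real_inner_comm (q i') (q (σ k)), real_inner_comm (p k) (p j),
          real_inner_comm (q (σ k)) (q j')])
  have hRi : R (p i) = q i' := hR 0
  have hRj : R (p j) = q j' := hR 1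
  have hRk : R (p k) = q (σ k) := hR 2
  have hRq : ∀ x y, ⟪x, R y⟫ = ⟪R.symm x, y⟫ := fun x y => by
    rw [← R.inner_map_map (R.symm x), R.apply_symm_apply]
  have hmax' : ∀ m, ⟪p m, n⟫ ≠ 0 → ⟪p m, e⟫ / |⟪p m, n⟫| ≤ ⟪p k, e⟫ / |⟪p k, n⟫| :=
    fun m hm => hmax m (by simp [hm])
  have hsim : ∀ {m m' l l'}, SameGram p q i m i' m' → R (p l) = q l' →
      ⟪p m, p l⟫ = ⟪q m', q l'⟫ → ‖p m‖ = ‖R.symm (q m')‖ ∧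
        ⟪p m, p i⟫ = ⟪R.symm (q m'), p i⟫ ∧ ⟪p m, p l⟫ = ⟪R.symm (q m'), p l⟫ := by
    intro m m' l l' h1 h2 h3
    refine ⟨by rw [R.symm.norm_map, h1.right], ?_, ?_⟩
    · rw [← hRq, hRi, real_inner_comm, h1.inner_eq, real_inner_comm]
    · rw [← hRq, h2, h3]
  have hS := fun m => hsim (hσ m).1 hRj (hσ m).2.1
  have hT := fun m => hsim (hτ m).1 hRk (hτ m).2
  -- Orient the normal so that p k is on its positive side.
  obtain ⟨n₁, hn₁, hn₁a, hn₁b, hen₁, hkn₁, habs⟩ : ∃ n₁ : E, n₁ ≠ 0 ∧ ⟪n₁, p i⟫ = 0 ∧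
      ⟪n₁, p j⟫ = 0 ∧ ⟪e, n₁⟫ = 0 ∧ 0 < ⟪p k, n₁⟫ ∧ ∀ x, |⟪x, n₁⟫| = |⟪x, n⟫| := by
    rcases hkn.lt_or_gt with hlt | hgt
    · exact ⟨-n, by simpa using hn, by simpa using hna, by simpa using hnb, by simpa using hen,
        by simpa using hlt, by simp⟩
    · exact ⟨n, hn, hna, hnb, hen, hgt, fun _ => rfl⟩
  obtain ⟨π, hπ⟩ := exists_equiv_of_two_planes (q := fun m => R.symm (q m)) hE hab hn₁ hn₁a hn₁b
    he0 hea hen₁ hkn₁ (fun m hm => by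
      rw [habs, habs]
      exact hmax' m (by rw [← abs_pos, ← habs]; exact abs_pos.2 hm))
    σ τ (fun m => (hS m).1) (fun m => (hS m).2.1) (fun m => (hS m).2.2)
    (fun m => (hT m).1) (fun m => (hT m).2.1) (fun m => (hT m).2.2)
  exact ⟨R, π, fun m => by rw [hπ, R.apply_symm_apply]⟩

end Reconstruction

/-- Finite families of pairs whose first components are restricted by a nonempty predicate
determine the family of second components. -/
theorem exists_equiv_of_prod_equiv {ι κ α : Type*} [Finite ι] [Finite κ] {F : ι → α} {G : κ → α}
    {A : ι → Prop} {B : κ → Prop} (hA : ∃ b, A b) (ρ : ι × ι ≃ κ × κ)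
    (hAB : ∀ r, A r.1 ↔ B (ρ r).1) (hFG : ∀ r, A r.1 → F r.2 = G (ρ r).2) :
    ∃ σ : ι ≃ κ, ∀ k, F k = G (σ k) := by
  have hcard : Nat.card ι = Nat.card κ := by
    have := Nat.card_congr ρ
    rw [Nat.card_prod, Nat.card_prod] at this
    exact Nat.mul_self_inj.1 this
  have hne : 0 < Nat.card {b // A b} := by
    obtain ⟨b, hb⟩ := hA
    have : Nonempty {b // A b} := ⟨⟨b, hb⟩⟩
    exact Nat.card_pos
  -- The restricted pairs form a product, so their number factors. Trivial predicates show that A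
  -- and B hold equally often; this common nonzero factor then cancels from the fiber counts.
  have key : ∀ (F' : ι → Prop) (G' : κ → Prop), (∀ r, A r.1 → (F' r.2 ↔ G' (ρ r).2)) →
      Nat.card {b // A b} * Nat.card {k // F' k} = Nat.card {b // B b} * Nat.card {k // G' k} := by
    intro F' G' h
    rw [← Nat.card_prod, ← Nat.card_prod]
    refine Nat.card_congr (Equiv.subtypeProdEquivProd.symm.trans
      ((ρ.subtypeEquiv fun r => ?_).trans Equiv.subtypeProdEquivProd))
    rw [← hAB]
    exact and_congr_right (h r)
  have hcardAB : Nat.card {b // A b} = Nat.card {b // B b} := by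
    have h1 := key (fun _ => True) (fun _ => True) (fun _ _ => Iff.rfl)
    rw [Nat.card_congr (Equiv.subtypeUnivEquiv fun _ => trivial),
      Nat.card_congr (Equiv.subtypeUnivEquiv fun _ => trivial), ← hcard] at h1
    obtain ⟨b, -⟩ := hA
    have : Nonempty ι := ⟨b⟩
    exact Nat.eq_of_mul_eq_mul_right Nat.card_pos h1
  refine exists_equiv_of_card_fiber_eq fun x => ?_
  have h1 := key (F · = x) (G · = x) (fun r hr => by rw [hFG r hr])
  rw [← hcardAB] at h1
  exact Nat.eq_of_mul_eq_mul_left hne h1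

/-! ### Rooted refinement and the centroid -/

namespace PointCloud

/-- Refinement of the pairs `(i, j)` of nodes, in which the first node is a root that all other
nodes see. -/
def LooksAlike : ℕ → ∀ {m n : ℕ}, PointCloud m → PointCloud n → Fin m → Fin m → Fin n → Fin n → Prop
  | 0, _, _, P, Q, i, j, i', j' => dist (P i) (P j) = dist (Q i') (Q j')
  | l + 1, m, n, P, Q, i, j, i', j' => dist (P i) (P j) = dist (Q i') (Q j') ∧
      ∃ σ : Fin m ≃ Fin n, ∀ k, dist (P k) (P j) = dist (Q (σ k)) (Q j') ∧
        LooksAlike l P Q i k i' (σ k)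

variable {m n : ℕ} {P : PointCloud m} {Q : PointCloud n} {i j : Fin m} {i' j' : Fin n}

theorem LooksAlike.dist_eq {l : ℕ} (h : LooksAlike l P Q i j i' j') :
    dist (P i) (P j) = dist (Q i') (Q j') := by
  cases l with
  | zero => exact h
  | succ l => exact h.1

theorem LooksAlike.of_succ {l : ℕ} (h : LooksAlike (l + 1) P Q i j i' j') :
    LooksAlike l P Q i j i' j' := by
  induction l generalizing j j' with
  | zero => exact h.1
  | succ l ih =>
    obtain ⟨h1, σ, hσ⟩ := h
    exact ⟨h1, σ, fun k => ⟨(hσ k).1, ih (hσ k).2⟩⟩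

/-- The position of a node relative to the centroid. -/
def centered (P : PointCloud n) (i : Fin n) : E3 := P i - (n : ℝ)⁻¹ • ∑ k, P k

theorem sum_centered (P : PointCloud n) : ∑ i, P.centered i = 0 := by
  rcases Nat.eq_zero_or_pos n with rfl | hn
  · simp
  · have : (n : ℝ) ≠ 0 := by positivity
    simp only [centered, Finset.sum_sub_distrib, Finset.sum_const, Finset.card_univ,
      Fintype.card_fin]
    rw [← Nat.cast_smul_eq_nsmul ℝ, smul_smul, mul_inv_cancel₀ this, one_smul, sub_self]

theorem dist_eq_norm_centered (P : PointCloud n) (i j : Fin n) :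
    dist (P i) (P j) = ‖P.centered i - P.centered j‖ := by
  rw [dist_eq_norm, centered, centered, sub_sub_sub_cancel_right]

/-- The parallel axis identity: the cross term vanishes because the centered positions sum to zero.
-/
theorem sum_dist_sq (P : PointCloud n) (j : Fin n) :
    ∑ k, dist (P k) (P j) ^ 2 = ∑ k, ‖P.centered k‖ ^ 2 + n * ‖P.centered j‖ ^ 2 := by
  simp only [dist_eq_norm_centered, norm_sub_sq_real, Finset.sum_add_distrib,
    Finset.sum_sub_distrib, ← Finset.mul_sum, ← sum_inner, sum_centered, inner_zero_left,
    Finset.sum_const, Finset.card_univ, Fintype.card_fin, nsmul_eq_mul]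
  ring

theorem LooksAlike.sum_dist_sq_eq {l : ℕ} (h : LooksAlike (l + 1) P Q i j i' j') :
    ∑ k, dist (P k) (P j) ^ 2 = ∑ k, dist (Q k) (Q j') ^ 2 := by
  obtain ⟨-, σ, hσ⟩ := h
  rw [← Equiv.sum_comp σ]
  exact Finset.sum_congr rfl fun k _ => by rw [(hσ k).1]

theorem LooksAlike.sum_dist_sq_root_eq {l : ℕ} (h : LooksAlike (l + 1) P Q i j i' j') :
    ∑ k, dist (P k) (P i) ^ 2 = ∑ k, dist (Q k) (Q i') ^ 2 := by
  obtain ⟨-, σ, hσ⟩ := h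
  rw [← Equiv.sum_comp σ]
  exact Finset.sum_congr rfl fun k _ => by rw [dist_comm, (hσ k).2.dist_eq, dist_comm]

theorem LooksAlike.size_eq {l : ℕ} (h : LooksAlike (l + 1) P Q i j i' j') : m = n := by
  obtain ⟨-, σ, -⟩ := h
  simpa using Fintype.card_congr σ

/-- Summing `sum_dist_sq` over j gives 2n times the moment about the centroid. One level reaches
every node k, and one more compares the distances at k. -/
theorem LooksAlike.sum_norm_sq_eq {l : ℕ} (h : LooksAlike (l + 2) P Q i j i' j') :
    ∑ k, ‖P.centered k‖ ^ 2 = ∑ k, ‖Q.centered k‖ ^ 2 := by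
  have hmn := h.size_eq
  obtain ⟨-, σ, hσ⟩ := h
  have h1 : ∑ j, ∑ k, dist (P k) (P j) ^ 2 = ∑ j, ∑ k, dist (Q k) (Q j) ^ 2 := by
    rw [← Equiv.sum_comp σ]
    exact Finset.sum_congr rfl fun k _ => (hσ k).2.sum_dist_sq_eq
  simp only [sum_dist_sq, Finset.sum_add_distrib, ← Finset.mul_sum, Finset.sum_const,
    Finset.card_univ, Fintype.card_fin, nsmul_eq_mul] at h1
  subst hmn
  have : (0 : ℝ) < m := by exact_mod_cast i.pos
  have h2 : (m : ℝ) * (∑ k, ‖P.centered k‖ ^ 2 - ∑ k, ‖Q.centered k‖ ^ 2) = 0 := by linarith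
  rcases mul_eq_zero.1 h2 with h3 | h3 <;> linarith

theorem norm_centered_eq (hmn : m = n)
    (h : ∑ k, ‖P.centered k‖ ^ 2 = ∑ k, ‖Q.centered k‖ ^ 2)
    (hj : ∑ k, dist (P k) (P j) ^ 2 = ∑ k, dist (Q k) (Q j') ^ 2) :
    ‖P.centered j‖ = ‖Q.centered j'‖ := by
  subst hmn
  have : (0 : ℝ) < m := by exact_mod_cast j.pos
  rw [sum_dist_sq, sum_dist_sq, h, add_right_inj] at hj
  exact (pow_left_inj₀ (norm_nonneg _) (norm_nonneg _) two_ne_zero).1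
    (mul_left_cancel₀ this.ne' hj)

theorem inner_centered_eq (hi : ‖P.centered i‖ = ‖Q.centered i'‖)
    (hj : ‖P.centered j‖ = ‖Q.centered j'‖) (hij : dist (P i) (P j) = dist (Q i') (Q j')) :
    inner ℝ (P.centered i) (P.centered j) = inner ℝ (Q.centered i') (Q.centered j') := by
  have h1 := norm_sub_sq_real (P.centered i) (P.centered j)
  have h2 := norm_sub_sq_real (Q.centered i') (Q.centered j')
  rw [← dist_eq_norm_centered] at h1 h2
  rw [hi, hj, hij] at h1
  linarith

theorem LooksAlike.sameGram {l : ℕ} (h : LooksAlike (l + 2) P Q i j i' j') :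
    SameGram P.centered Q.centered i j i' j' := by
  have hi := norm_centered_eq h.size_eq h.sum_norm_sq_eq h.sum_dist_sq_root_eq
  have hj := norm_centered_eq h.size_eq h.sum_norm_sq_eq h.sum_dist_sq_eq
  exact ⟨hi, hj, inner_centered_eq hi hj h.dist_eq⟩

/-- Two of the four levels are spent on passing to k and then to all r; the remaining two give the
Gram data of (i, r). -/
theorem isomorphic_of_looksAlike (hm : 0 < m)
    (h : ∀ i j, ∃ i' j', LooksAlike 4 P Q i j i' j') : P.Isomorphic Q := by
  have : Nonempty (Fin m) := ⟨⟨0, hm⟩⟩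
  obtain ⟨R, π, hπ⟩ := exists_equiv_of_sameGram (p := P.centered) (q := Q.centered)
    (by simp) (fun i j => by
      obtain ⟨i', j', hij⟩ := h i j
      have hij' := hij.sameGram
      obtain ⟨-, σ, hσ⟩ := hij
      refine ⟨i', j', hij', σ, fun k => ?_⟩
      obtain ⟨hkj, hk⟩ := hσ k
      have hk' := hk.sameGram
      obtain ⟨-, τ, hτ⟩ := hk
      refine ⟨hk', inner_centered_eq hk'.right hij'.right hkj, τ, fun r => ?_⟩
      obtain ⟨hrk, hr⟩ := hτ r
      exact ⟨hr.sameGram, inner_centered_eq hr.sameGram.right hk'.right hrk⟩)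
  refine ⟨π, R, (n : ℝ)⁻¹ • ∑ k, Q k - R ((m : ℝ)⁻¹ • ∑ k, P k), fun i => ?_⟩
  have := hπ i
  rw [centered, centered, map_sub] at this
  rw [← add_sub_assoc, add_sub_right_comm, this, sub_add_cancel]

/-- `i ↦ σ i` is induced by the rigid motion `x ↦ R x + t`. -/
def IsMatching (P : PointCloud m) (Q : PointCloud n) (σ : Fin m ≃ Fin n) (R : E3 ≃ₗᵢ[ℝ] E3)
    (t : E3) : Prop := ∀ i, Q (σ i) = R (P i) + t

theorem isMatching_refl (P : PointCloud n) :
    P.IsMatching P (Equiv.refl _) (LinearIsometryEquiv.refl ℝ E3) 0 := fun i => by simp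

theorem within_top (P : PointCloud n) (i : Fin n) : P.within ⊤ i = Finset.univ := by
  simp [within]

end PointCloud

/-! ### Isometry invariance and the law of cosines -/

theorem dist_rigid (R : E3 ≃ₗᵢ[ℝ] E3) (t x y : E3) : dist (R x + t) (R y + t) = dist x y := by
  rw [dist_add_right, R.dist_map]

theorem angle_rigid (R : E3 ≃ₗᵢ[ℝ] E3) (t x y z : E3) :
    EuclideanGeometry.angle (R x + t) (R y + t) (R z + t) = EuclideanGeometry.angle x y z := by
  simp only [EuclideanGeometry.angle, vsub_eq_sub, add_sub_add_right_eq_sub, ← map_sub]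
  exact R.toLinearIsometry.angle_map _ _

theorem perpComponent_map (R : E3 ≃ₗᵢ[ℝ] E3) (w u : E3) :
    perpComponent (R w) (R u) = R (perpComponent w u) := by
  simp only [perpComponent, R.inner_map_map, map_sub, map_smul]

theorem dihedralAngle_rigid (R : E3 ≃ₗᵢ[ℝ] E3) (t x y z w : E3) :
    dihedralAngle (R x + t) (R y + t) (R z + t) (R w + t) = dihedralAngle x y z w := by
  simp only [dihedralAngle, add_sub_add_right_eq_sub, ← map_sub, perpComponent_map]
  exact R.toLinearIsometry.angle_map _ _

/-- The law of cosines. It also holds for degenerate angles, whose cosine is multiplied by a zero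
length. -/
theorem dist_eq_of_angle_eq {x y z x' y' z' : E3} (hxy : dist x y = dist x' y')
    (hzy : dist z y = dist z' y')
    (h : EuclideanGeometry.angle x y z = EuclideanGeometry.angle x' y' z') :
    dist x z = dist x' z' := by
  have h1 := EuclideanGeometry.law_cos x y z
  have h2 := EuclideanGeometry.law_cos x' y' z'
  rw [hxy, hzy, h, ← h2] at h1
  exact (mul_self_inj dist_nonneg dist_nonneg).1 h1

theorem map_univ_eq_of_equiv {ι κ α : Type*} [Fintype ι] [Fintype κ] {f : ι → α} {g : κ → α}
    (σ : ι ≃ κ) (h : ∀ i, f i = g (σ i)) :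
    (Finset.univ : Finset ι).val.map f = (Finset.univ : Finset κ).val.map g := by
  rw [← Multiset.map_univ_val_equiv σ, Multiset.map_map]
  exact Multiset.map_congr rfl fun i _ => h i

/-! ### Directed refinement -/

/-- A family of colorings of the pairs of nodes, one for each layer, that refines itself by the
directed message passing common to all the models. -/
structure IsDirectedRefinement {H : ℕ → Type u} (L : ℕ)
    (c : ∀ (l : ℕ) {n : ℕ}, PointCloud n → Fin n → Fin n → H l) : Prop where
  dist_eq : ∀ {m n : ℕ} {P : PointCloud m} {Q : PointCloud n} {i j i' j'},
    c 0 P i j = c 0 Q i' j' → dist (P i) (P j) = dist (Q i') (Q j')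
  of_succ : ∀ {l : ℕ}, l < L → ∀ {m n : ℕ} {P : PointCloud m} {Q : PointCloud n} {i j i' j'},
    c (l + 1) P i j = c (l + 1) Q i' j' → c l P i j = c l Q i' j'
  exists_equiv : ∀ {l : ℕ}, l < L → ∀ {m n : ℕ} {P : PointCloud m} {Q : PointCloud n} {i j i' j'},
    c (l + 1) P i j = c (l + 1) Q i' j' → ∃ σ : Fin m ≃ Fin n, ∀ k,
      dist (P k) (P j) = dist (Q (σ k)) (Q j') ∧ c l P k i = c l Q (σ k) i'
  -- Only the positions of i' and j' are prescribed, not i' = σ i. With the identity motion, this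
  -- makes coincident nodes interchangeable.
  eq_of_matching : ∀ (l : ℕ) {m n : ℕ} {P : PointCloud m} {Q : PointCloud n} {σ R t},
    P.IsMatching Q σ R t → ∀ {i j i' j'}, Q i' = R (P i) + t → Q j' = R (P j) + t →
      c l P i j = c l Q i' j'

namespace IsDirectedRefinement

variable {H : ℕ → Type u} {L : ℕ} {c : ∀ (l : ℕ) {n : ℕ}, PointCloud n → Fin n → Fin n → H l}
  {m n : ℕ} {P : PointCloud m} {Q : PointCloud n}

theorem of_le (hc : IsDirectedRefinement L c) {k l : ℕ} (hkl : k ≤ l) (hl : l ≤ L) {i j i' j'}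
    (h : c l P i j = c l Q i' j') : c k P i j = c k Q i' j' := by
  induction l, hkl using Nat.le_induction with
  | base => exact h
  | succ l _ ih => exact ih (by omega) (hc.of_succ (by omega) h)

/-- A directed step replaces (i, j) by (k, i) and loses j. A second step from (k, i), read at the
neighbor i, gives (i, k): the node matched with i is at distance zero from i', so it may be replaced
by i'. Hence two layers per rooted round. -/
theorem looksAlike (hc : IsDirectedRefinement L c) {l : ℕ} (hl : 2 * l ≤ L) {i j i' j'}
    (h : c (2 * l) P i j = c (2 * l) Q i' j') : PointCloud.LooksAlike l P Q i j i' j' := by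
  induction l generalizing j j' with
  | zero => exact hc.dist_eq h
  | succ l ih =>
    refine ⟨hc.dist_eq (hc.of_le (Nat.zero_le _) hl h), ?_⟩
    obtain ⟨σ, hσ⟩ := hc.exists_equiv (l := 2 * l + 1) (by omega) h
    refine ⟨σ, fun k => ⟨(hσ k).1, ih (by omega) ?_⟩⟩
    obtain ⟨τ, hτ⟩ := hc.exists_equiv (l := 2 * l) (by omega) (hσ k).2
    obtain ⟨h1, h2⟩ := hτ i
    rw [dist_self, eq_comm, dist_eq_zero] at h1
    rw [h2]
    exact hc.eq_of_matching _ Q.isMatching_refl (by simp [h1]) (by simp)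

theorem e3Complete (hc : IsDirectedRefinement L c) (hL : 8 ≤ L) {T : Type v}
    {f : ∀ n : ℕ, PointCloud n → T}
    (hf : ∀ {m n : ℕ} (P : PointCloud m) (Q : PointCloud n), f m P = f n Q ↔
      (Finset.univ : Finset (Fin m)).val.map
        (fun j => (Finset.univ : Finset (Fin m)).val.map fun i => c L P i j) =
      (Finset.univ : Finset (Fin n)).val.map
        (fun j => (Finset.univ : Finset (Fin n)).val.map fun i => c L Q i j)) :
    E3Complete f where
  invariant P Q := by
    rintro ⟨σ, R, t, h⟩
    exact (hf P Q).2 (map_univ_eq_of_equiv σ fun j => map_univ_eq_of_equiv σ fun i =>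
      hc.eq_of_matching L h (h i) (h j))
  distinguishes {m n} P Q := by
    refine mt fun h => ?_
    obtain ⟨σ, hσ⟩ := exists_equiv_of_map_univ_eq ((hf P Q).1 h)
    rcases Nat.eq_zero_or_pos m with rfl | hm
    · exact ⟨σ, LinearIsometryEquiv.refl ℝ E3, 0, fun i => i.elim0⟩
    · refine PointCloud.isomorphic_of_looksAlike hm fun i j => ?_
      obtain ⟨τ, hτ⟩ := exists_equiv_of_map_univ_eq (hσ j)
      exact ⟨τ i, σ j, hc.looksAlike (l := 4) hL (hc.of_le hL le_rfl (hτ i))⟩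

end IsDirectedRefinement

/-! ### The three models as directed refinements -/

theorem DimeNet.edgeRep_succ {L : ℕ} {T : Type v} {M : DimeNet.{u, v} L T} (hE : M.rEmbed = ⊤)
    (hI : M.rInt = ⊤) {n : ℕ} (P : PointCloud n) (l : ℕ) (i j : Fin n) :
    M.edgeRep P (l + 1) i j = M.update l (M.edgeRep P l i j,
      (Finset.univ : Finset (Fin n)).val.map fun k =>
        (EuclideanGeometry.angle (P k) (P i) (P j), M.edgeRep P l k i, dist (P i) (P j))) := by
  simp only [edgeRep, hE, hI, PointCloud.within_top, Finset.univ_inter]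

theorem SphereNet.edgeRep_succ {L : ℕ} {T : Type v} {M : SphereNet.{u, v} L T}
    (hE : M.rEmbed = ⊤) (hI : M.rInt = ⊤) {n : ℕ} (P : PointCloud n) (l : ℕ) (i j : Fin n) :
    M.edgeRep P (l + 1) i j = M.update l (M.edgeRep P l i j,
      M.node l ((Finset.univ : Finset (Fin n)).val.map fun k => M.edgeRep P l k i),
      M.node l ((Finset.univ : Finset (Fin n)).val.map fun k => M.edgeRep P l k j),
      (Finset.univ : Finset (Fin n)).val.map fun k =>
        (M.edgeRep P l k i, dist (P k) (P i), EuclideanGeometry.angle (P k) (P i) (P j))) := by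
  simp only [edgeRep, nodeRep, hE, hI, PointCloud.within_top, Finset.univ_inter]

theorem GemNet.edgeRep_succ {L : ℕ} {T : Type v} {M : GemNet.{u, v} L T} (hE : M.rEmbed = ⊤)
    (hI : M.rInt = ⊤) {n : ℕ} (P : PointCloud n) (l : ℕ) (i j : Fin n) :
    M.edgeRep P (l + 1) i j = M.update l (M.edgeRep P l i j,
      (Finset.univ : Finset (Σ _ : Fin n, Fin n)).val.map fun q =>
        (M.edgeRep P l q.2 q.1,
          dist (P i) (P j), dist (P q.1) (P j), dist (P q.2) (P q.1),
          EuclideanGeometry.angle (P i) (P j) (P q.1),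
          EuclideanGeometry.angle (P j) (P q.1) (P q.2),
          dihedralAngle (P i) (P j) (P q.1) (P q.2))) := by
  simp only [edgeRep, hE, hI, PointCloud.within_top, Finset.univ_sigma_univ]

theorem DimeNet.edgeRep_eq_of_matching {L : ℕ} {T : Type v} {M : DimeNet.{u, v} L T}
    (hE : M.rEmbed = ⊤) (hI : M.rInt = ⊤) (l : ℕ) {m n : ℕ} {P : PointCloud m} {Q : PointCloud n}
    {σ R t} (h : P.IsMatching Q σ R t) {i j i' j'} (hi : Q i' = R (P i) + t)
    (hj : Q j' = R (P j) + t) : M.edgeRep P l i j = M.edgeRep Q l i' j' := by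
  induction l generalizing i j i' j' with
  | zero => simp only [edgeRep, hi, hj, dist_rigid]
  | succ l ih =>
    rw [edgeRep_succ hE hI, edgeRep_succ hE hI, ih hi hj]
    congr 2
    refine map_univ_eq_of_equiv σ fun k => ?_
    rw [ih (h k) hi, h k, hi, hj, dist_rigid, angle_rigid]

theorem SphereNet.edgeRep_eq_of_matching {L : ℕ} {T : Type v} {M : SphereNet.{u, v} L T}
    (hE : M.rEmbed = ⊤) (hI : M.rInt = ⊤) (l : ℕ) {m n : ℕ} {P : PointCloud m} {Q : PointCloud n}
    {σ R t} (h : P.IsMatching Q σ R t) {i j i' j'} (hi : Q i' = R (P i) + t)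
    (hj : Q j' = R (P j) + t) : M.edgeRep P l i j = M.edgeRep Q l i' j' := by
  induction l generalizing i j i' j' with
  | zero => simp only [edgeRep, hi, hj, dist_rigid]
  | succ l ih =>
    rw [edgeRep_succ hE hI, edgeRep_succ hE hI, ih hi hj]
    have hnode : ∀ {r r'}, Q r' = R (P r) + t →
        (Finset.univ : Finset (Fin m)).val.map (fun k => M.edgeRep P l k r) =
          (Finset.univ : Finset (Fin n)).val.map fun k => M.edgeRep Q l k r' :=
      fun hr => map_univ_eq_of_equiv σ fun k => ih (h k) hr
    rw [hnode hi, hnode hj]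
    congr 4
    refine map_univ_eq_of_equiv σ fun k => ?_
    rw [ih (h k) hi, h k, hi, hj, dist_rigid, angle_rigid]

theorem GemNet.edgeRep_eq_of_matching {L : ℕ} {T : Type v} {M : GemNet.{u, v} L T}
    (hE : M.rEmbed = ⊤) (hI : M.rInt = ⊤) (l : ℕ) {m n : ℕ} {P : PointCloud m} {Q : PointCloud n}
    {σ R t} (h : P.IsMatching Q σ R t) {i j i' j'} (hi : Q i' = R (P i) + t)
    (hj : Q j' = R (P j) + t) : M.edgeRep P l i j = M.edgeRep Q l i' j' := by
  induction l generalizing i j i' j' with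
  | zero => simp only [edgeRep, hi, hj, dist_rigid]
  | succ l ih =>
    rw [edgeRep_succ hE hI, edgeRep_succ hE hI, ih hi hj]
    congr 2
    refine map_univ_eq_of_equiv (Equiv.sigmaCongr σ fun _ => σ) fun ⟨b, a⟩ => ?_
    change _ = (M.edgeRep Q l (σ a) (σ b), dist (Q i') (Q j'), dist (Q (σ b)) (Q j'),
      dist (Q (σ a)) (Q (σ b)), EuclideanGeometry.angle (Q i') (Q j') (Q (σ b)),
      EuclideanGeometry.angle (Q j') (Q (σ b)) (Q (σ a)),
      dihedralAngle (Q i') (Q j') (Q (σ b)) (Q (σ a)))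
    rw [ih (h a) (h b), h a, h b, hi, hj]
    simp only [dist_rigid, angle_rigid, dihedralAngle_rigid]

/-- The representations retain d_ki and d_ij, which with the angle at i determine d_kj. -/
theorem DimeNet.isDirectedRefinement {L : ℕ} {T : Type v} {M : DimeNet.{u, v} L T}
    (hM : M.AllInjective) (hE : M.rEmbed = ⊤) (hI : M.rInt = ⊤) :
    IsDirectedRefinement L fun l {_} P => M.edgeRep P l := by
  have hsucc : ∀ {l : ℕ}, l < L → ∀ {m n : ℕ} {P : PointCloud m} {Q : PointCloud n} {i j i' j'},
      M.edgeRep P (l + 1) i j = M.edgeRep Q (l + 1) i' j' →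
        M.edgeRep P l i j = M.edgeRep Q l i' j' := by
    intro l hl m n P Q i j i' j' h
    rw [edgeRep_succ hE hI, edgeRep_succ hE hI] at h
    exact (Prod.ext_iff.1 (hM.update l hl h)).1
  have hdist : ∀ {l : ℕ}, l ≤ L → ∀ {m n : ℕ} {P : PointCloud m} {Q : PointCloud n} {i j i' j'},
      M.edgeRep P l i j = M.edgeRep Q l i' j' → dist (P i) (P j) = dist (Q i') (Q j') := by
    intro l hl m n P Q i j i' j' h
    induction l with
    | zero => simpa using hM.init h
    | succ l ih => exact ih (by omega) (hsucc hl h)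
  refine ⟨hdist (Nat.zero_le _), hsucc, ?_, edgeRep_eq_of_matching hE hI⟩
  intro l hl m n P Q i j i' j' h
  have hij := hdist hl h
  rw [edgeRep_succ hE hI, edgeRep_succ hE hI] at h
  obtain ⟨σ, hσ⟩ := exists_equiv_of_map_univ_eq (Prod.mk.inj (hM.update l hl h)).2
  refine ⟨σ, fun k => ?_⟩
  have hk := hσ k
  simp only [Prod.mk.injEq] at hk
  exact ⟨dist_eq_of_angle_eq (hdist hl.le hk.2.1) (by rw [dist_comm, hij, dist_comm]) hk.1, hk.2.1⟩

theorem SphereNet.isDirectedRefinement {L : ℕ} {T : Type v} {M : SphereNet.{u, v} L T}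
    (hM : M.AllInjective) (hE : M.rEmbed = ⊤) (hI : M.rInt = ⊤) :
    IsDirectedRefinement L fun l {_} P => M.edgeRep P l := by
  have hsucc : ∀ {l : ℕ}, l < L → ∀ {m n : ℕ} {P : PointCloud m} {Q : PointCloud n} {i j i' j'},
      M.edgeRep P (l + 1) i j = M.edgeRep Q (l + 1) i' j' →
        M.edgeRep P l i j = M.edgeRep Q l i' j' := by
    intro l hl m n P Q i j i' j' h
    rw [edgeRep_succ hE hI, edgeRep_succ hE hI] at h
    exact (Prod.ext_iff.1 (hM.update l hl h)).1
  have hdist : ∀ {l : ℕ}, l ≤ L → ∀ {m n : ℕ} {P : PointCloud m} {Q : PointCloud n} {i j i' j'},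
      M.edgeRep P l i j = M.edgeRep Q l i' j' → dist (P i) (P j) = dist (Q i') (Q j') := by
    intro l hl m n P Q i j i' j' h
    induction l with
    | zero => simpa using hM.init h
    | succ l ih => exact ih (by omega) (hsucc hl h)
  refine ⟨hdist (Nat.zero_le _), hsucc, ?_, edgeRep_eq_of_matching hE hI⟩
  intro l hl m n P Q i j i' j' h
  have hij := hdist hl h
  rw [edgeRep_succ hE hI, edgeRep_succ hE hI] at h
  have h' := hM.update l hl h
  simp only [Prod.mk.injEq] at h'
  obtain ⟨σ, hσ⟩ := exists_equiv_of_map_univ_eq h'.2.2.2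
  refine ⟨σ, fun k => ?_⟩
  have hk := hσ k
  simp only [Prod.mk.injEq] at hk
  exact ⟨dist_eq_of_angle_eq hk.2.1 (by rw [dist_comm, hij, dist_comm]) hk.2.2, hk.1⟩

/-- Messages run over pairs (b, a). Those with b located at i are recognizable, as d_ij, d_bj and
the angle at j determine d_ib. For them h_ab is the representation of (a, i), and d_bj, d_ab and the
angle at b determine d_aj. Several nodes may sit at i, so each a is counted with that multiplicity,
which `exists_equiv_of_prod_equiv` divides out. -/
theorem GemNet.isDirectedRefinement {L : ℕ} {T : Type v} {M : GemNet.{u, v} L T}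
    (hM : M.AllInjective) (hE : M.rEmbed = ⊤) (hI : M.rInt = ⊤) :
    IsDirectedRefinement L fun l {_} P => M.edgeRep P l := by
  have hsucc : ∀ {l : ℕ}, l < L → ∀ {m n : ℕ} {P : PointCloud m} {Q : PointCloud n} {i j i' j'},
      M.edgeRep P (l + 1) i j = M.edgeRep Q (l + 1) i' j' →
        M.edgeRep P l i j = M.edgeRep Q l i' j' := by
    intro l hl m n P Q i j i' j' h
    rw [edgeRep_succ hE hI, edgeRep_succ hE hI] at h
    exact (Prod.ext_iff.1 (hM.update l hl h)).1
  refine ⟨fun h => by simpa using hM.init h, hsucc, ?_, edgeRep_eq_of_matching hE hI⟩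
  intro l hl m n P Q i j i' j' h
  rw [edgeRep_succ hE hI, edgeRep_succ hE hI] at h
  obtain ⟨ρ, hρ⟩ := exists_equiv_of_map_univ_eq (Prod.mk.inj (hM.update l hl h)).2
  simp only [Prod.mk.injEq] at hρ
  have hb : ∀ r, P r.1 = P i ↔ Q (ρ r).1 = Q i' := fun r => by
    rw [eq_comm, ← dist_eq_zero, eq_comm (a := Q _), ← dist_eq_zero (x := Q _),
      dist_eq_of_angle_eq (hρ r).2.1 (hρ r).2.2.1 (hρ r).2.2.2.2.1]
  obtain ⟨σ, hσ⟩ := exists_equiv_of_prod_equiv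
    (F := fun k => (dist (P k) (P j), M.edgeRep P l k i))
    (G := fun k => (dist (Q k) (Q j'), M.edgeRep Q l k i'))
    (A := fun b => P b = P i) (B := fun b => Q b = Q i') ⟨i, rfl⟩
    (((Equiv.sigmaEquivProd _ _).symm.trans ρ).trans (Equiv.sigmaEquivProd _ _))
    (fun r => hb ⟨r.1, r.2⟩) (fun r hr => by
      set s : Σ _ : Fin m, Fin m := ⟨r.1, r.2⟩ with hs
      change (dist (P s.2) (P j), M.edgeRep P l s.2 i) =
        (dist (Q (ρ s).2) (Q j'), M.edgeRep Q l (ρ s).2 i')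
      have hPs : P s.1 = P i := hr
      have hQs : Q (ρ s).1 = Q i' := (hb s).1 hPs
      obtain ⟨h1, -, h2, h3, -, h4, -⟩ := hρ s
      refine Prod.ext ?_ ?_
      · change dist _ _ = dist _ _
        rw [dist_comm, dist_comm (Q _)]
        exact dist_eq_of_angle_eq (by rw [dist_comm, h2, dist_comm]) h3 h4
      · change M.edgeRep P l _ _ = M.edgeRep Q l _ _
        rw [edgeRep_eq_of_matching hE hI l P.isMatching_refl (i := s.2) (j := i) (i' := s.2)
          (j' := s.1) (by simp) (by simp [hPs]), h1]
        exact edgeRep_eq_of_matching hE hI l Q.isMatching_refl (by simp) (by simp [hQs]))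
  exact ⟨σ, fun k => by simpa using hσ k⟩

theorem DimeNet.e3Complete {L : ℕ} (hL : 8 ≤ L) {T : Type v} {M : DimeNet.{u, v} L T}
    (hM : M.AllInjective) (hE : M.rEmbed = ⊤) (hI : M.rInt = ⊤) : E3Complete M.eval :=
  (isDirectedRefinement hM hE hI).e3Complete hL fun P Q => by
    simp only [eval, hE, PointCloud.within_top]
    exact hM.output.eq_iff

theorem SphereNet.e3Complete {L : ℕ} (hL : 8 ≤ L) {T : Type v} {M : SphereNet.{u, v} L T}
    (hM : M.AllInjective) (hE : M.rEmbed = ⊤) (hI : M.rInt = ⊤) : E3Complete M.eval :=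
  (isDirectedRefinement hM hE hI).e3Complete hL fun {m n} P Q => by
    simp only [eval, nodeRep, hE, PointCloud.within_top]
    have key : ∀ {n : ℕ} (P : PointCloud n), ((Finset.univ : Finset (Fin n)).val.map fun j =>
        M.node L ((Finset.univ : Finset (Fin n)).val.map fun i => M.edgeRep P L i j)) =
        ((Finset.univ : Finset (Fin n)).val.map fun j =>
          (Finset.univ : Finset (Fin n)).val.map fun i => M.edgeRep P L i j).map (M.node L) :=
      fun P => by rw [Multiset.map_map]; rfl
    rw [hM.graph.eq_iff, key, key, (Multiset.map_injective (hM.node L le_rfl)).eq_iff]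

theorem GemNet.e3Complete {L : ℕ} (hL : 8 ≤ L) {T : Type v} {M : GemNet.{u, v} L T}
    (hM : M.AllInjective) (hE : M.rEmbed = ⊤) (hI : M.rInt = ⊤) : E3Complete M.eval :=
  (isDirectedRefinement hM hE hI).e3Complete hL fun P Q => by
    simp only [eval, hE, PointCloud.within_top]
    exact hM.output.eq_iff

end

theorem theorem5 :
    ∃ C : ℕ, ∀ L : ℕ, C < L → ∀ T : Type v,
      (∀ M : DimeNet.{u, v} L T, M.AllInjective → M.rEmbed = ⊤ → M.rInt = ⊤ →
        E3Complete M.eval) ∧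
      (∀ M : SphereNet.{u, v} L T, M.AllInjective → M.rEmbed = ⊤ → M.rInt = ⊤ →
        E3Complete M.eval) ∧
      (∀ M : GemNet.{u, v} L T, M.AllInjective → M.rEmbed = ⊤ → M.rInt = ⊤ →
        E3Complete M.eval) :=
  ⟨7, fun _ hL _ => ⟨fun _ => DimeNet.e3Complete hL, fun _ => SphereNet.e3Complete hL,
    fun _ => GemNet.e3Complete hL⟩⟩
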